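/- Consider the secretary problem with a random number $N$ of candidates. The law $\mathbf p$ of $N$ is a probability distribution on $\{1,2,\dots\}$; given $N=i$, the $i$ candidates (no ties) arrive in uniformly random order, and at each time the relative rank of the arriving candidate among those seen so far is revealed. A strategy is a sequence $\mathbf q=(q_1,q_2,\dots)\in[0,1]^{\mathbb N}$: at time $t\le N$, if nothing has been accepted before and the $t$-th candidate is the best seen so far, it is accepted with probability $q_t$, independently of everything else; otherwise it is rejected. Let $A(\mathbf p,\mathbf q)$ be the probability that the accepted candidate is the best of all $N$ candidates. For $\eta\ge 0$, the strategy $\hat{\mathbf q}$ is called $\eta$-suboptimal for $\mathbf p$ if $A(\mathbf p,\hat{\mathbf q})\ge\sup_{\mathbf q}A(\mathbf p,\mathbf q)-\eta$. A learning algorithm with $m$ samples is a (possibly randomized) map that receives $m$ i.i.d. samples from an unknown law $\mathbf p$ and outputs a strategy. Theorem. There are numbers $c_n>0$, $n\ge 3$, with $\lim_{n\to\infty}c_n=\frac{1}{1+e}$, such that for all $n\ge 3$, all $0<\varepsilon<c_n$ and all $m\ge 0$ the following holds. If some learning algorithm with $m$ samples outputs, for every law $\mathbf p$ supported on $\{1,n\}$,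 an $\varepsilon/3$-suboptimal strategy for $\mathbf p$ with probability at least $2/3$ (over the samples and the randomness of the algorithm), then $$m\ \ge\ \frac{c_n-\varepsilon}{9\varepsilon^2}.$$ -/

import Mathlib

open MeasureTheory ProbabilityTheory Filter Topology

noncomputable section

namespace RandomHorizonSecretary

/-- The discrete `σ`-algebra on the positive integers. -/
instance instMeasurableSpacePNat : MeasurableSpace ℕ+ := ⊤

instance instDiscreteMeasurableSpacePNat : DiscreteMeasurableSpace ℕ+ := ⟨fun _ => trivial⟩

/-- A strategy `q = (q₁, q₂, …)` with `qₜ ∈ [0,1]`: `q t` is the conditional probability of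
accepting the `t`-th candidate given that the process is still running at time `t`, that this
candidate is the best one seen so far, and that nothing has been accepted before. -/
abbrev Strategy : Type := ℕ+ → unitInterval

/-- Arrival order of `i` candidates without ties: `σ t` is the value (only the order of the values
matters) of the candidate arriving at time `t + 1`, where `t : Fin i`; larger is better.
`IsRecord σ t`: this candidate has relative rank `1` among those that have arrived. -/
abbrev IsRecord {i : ℕ} (σ : Equiv.Perm (Fin i)) (t : Fin i) : Prop :=
  ∀ s : Fin i, s ≤ t → σ s ≤ σ t

/-- `IsOverallBest σ t`: the candidate arriving at time `t + 1` is the best of all `i`. -/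
abbrev IsOverallBest {i : ℕ} (σ : Equiv.Perm (Fin i)) (t : Fin i) : Prop :=
  ∀ s : Fin i, σ s ≤ σ t

/-- Given the arrival order, the probability that the strategy accepts at time `t + 1` when it has
not accepted before: the bias `q (t + 1)` of a fresh coin at a record, and `0` otherwise. -/
def acceptProb (q : Strategy) {i : ℕ} (σ : Equiv.Perm (Fin i)) (t : Fin i) : ℝ :=
  if IsRecord σ t then (q (Nat.succPNat (t : ℕ)) : ℝ) else 0

/-- Given the arrival order, the probability (over the independent coins) that the candidate
picked by the strategy is the one arriving at time `t + 1`. -/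
def pickProb (q : Strategy) {i : ℕ} (σ : Equiv.Perm (Fin i)) (t : Fin i) : ℝ :=
  (∏ s ∈ Finset.univ.filter (fun s : Fin i => s < t), (1 - acceptProb q σ s)) * acceptProb q σ t

/-- Probability that the strategy picks the best candidate when exactly `i` candidates arrive, in
uniformly random order. -/
def winProb (q : Strategy) (i : ℕ) : ℝ :=
  (∑ σ : Equiv.Perm (Fin i), ∑ t : Fin i, if IsOverallBest σ t then pickProb q σ t else 0)
    / (Nat.factorial i : ℝ)

/-- Probability that the strategy picks the best of the `N` arriving candidates, when `N` has law
`p` and, given `N`, the arrival order is uniformly random. -/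
def successProb (p : PMF ℕ+) (q : Strategy) : ℝ :=
  ∑' i : ℕ+, (p i).toReal * winProb q (i : ℕ)

/-- The strategy `q` is `η`-suboptimal for the law `p`: its success probability is at least
`sup_{q'} successProb p q' - η`. -/
def IsSuboptimal (p : PMF ℕ+) (η : ℝ) (q : Strategy) : Prop :=
  ∀ q' : Strategy, successProb p q' - η ≤ successProb p q

/-- A (possibly randomized) learning algorithm using `m` samples: a Markov kernel sending the
samples to the law of the strategy it outputs. `learnProb p η alg` is the probability, over `m`
i.i.d. samples from `p` and the internal randomness of the algorithm, that the output is
`η`-suboptimal for `p`. -/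
def learnProb {m : ℕ} (p : PMF ℕ+) (η : ℝ) (alg : Kernel (Fin m → ℕ+) Strategy) : ENNReal :=
  ((Measure.pi fun _ : Fin m => p.toMeasure).bind alg) {q | IsSuboptimal p η q}

end RandomHorizonSecretary

end

/-! Let `N` be `1` with probability `a` and `n` otherwise, and let `v = skipValue n`. Accepting the
first candidate wins with probability `a + (1 - a) / n`; rejecting it allows up to `(1 - a) * v`.
With `D = v - 1 / n` the two agree at `a = D / (1 + D)`, which is `criticalWeight n`. Since `v`
tends to `1 / e`, this weight tends to `1 / (1 + e)`.

Moving `a` by `2ε/3` off the critical weight separates the two options by `(2ε/3)(1 + D) > 2ε/3`. An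
`ε/3`-suboptimal strategy must then have `q 1 > 1/2` on the upper side and `q 1 < 1/2` on the lower
side. So a learning algorithm yields a test between two Bernoulli laws at distance `4ε/3` with both
errors at most `1/3`. Hellinger affinity `ρ` bounds the sample size: it is multiplicative over
samples, such a test forces `ρ ^ (2m) ≤ 8/9`, and `(c - ε)(1 - ρ²) ≤ ε²`.

The main ingredients are the recursion `winProb_succ`, the limit `tendsto_skipValue`, the testing
bound `one_le_nine_mul_of_test` and the two lemmas turning suboptimality into a decision about `q
1`. -/

namespace RandomHorizonSecretary

/-! ### Recursion for the winning probability in the number of candidates -/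

/-- The arrival order of `n + 1` candidates in which the last one has rank `p`, counted from the
worst, and the earlier ones are ordered by `σ`. -/
def appendRank {n : ℕ} (p : Fin (n + 1)) (σ : Equiv.Perm (Fin n)) : Equiv.Perm (Fin (n + 1)) :=
  finSuccEquivLast.trans ((Equiv.optionCongr σ).trans (finSuccEquiv' p).symm)

@[simp] lemma appendRank_last {n : ℕ} (p : Fin (n + 1)) (σ : Equiv.Perm (Fin n)) :
    appendRank p σ (Fin.last n) = p := by
  simp [appendRank]

@[simp] lemma appendRank_castSucc {n : ℕ} (p : Fin (n + 1)) (σ : Equiv.Perm (Fin n)) (i : Fin n) :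
    appendRank p σ i.castSucc = p.succAbove (σ i) := by
  simp [appendRank]

lemma appendRank_bijective (n : ℕ) :
    Function.Bijective
      (fun x : Fin (n + 1) × Equiv.Perm (Fin n) => appendRank x.1 x.2) := by
  rw [Fintype.bijective_iff_injective_and_card]
  constructor
  · rintro ⟨p, σ⟩ ⟨p', σ'⟩ h
    have hp : p = p' := by simpa using congrArg (fun τ => τ (Fin.last n)) h
    subst hp
    have hσ : σ = σ' := by
      ext i : 1
      simpa using congrArg (fun τ => τ i.castSucc) h
    rw [hσ]
  · simp [Fintype.card_perm, Nat.factorial_succ]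

lemma sum_perm_succ {n : ℕ} (f : Equiv.Perm (Fin (n + 1)) → ℝ) :
    ∑ τ, f τ = ∑ p : Fin (n + 1), ∑ σ : Equiv.Perm (Fin n), f (appendRank p σ) := by
  rw [← Fintype.sum_prod_type']
  exact ((appendRank_bijective n).sum_comp f).symm

lemma isRecord_appendRank_castSucc {n : ℕ} (p : Fin (n + 1)) (σ : Equiv.Perm (Fin n)) (t : Fin n) :
    IsRecord (appendRank p σ) t.castSucc ↔ IsRecord σ t := by
  constructor
  · intro h s hs
    simpa using h s.castSucc (by simpa using hs)
  · intro h s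
    induction s using Fin.lastCases with
    | last => intro hs; exact absurd hs (by simp [Fin.le_def])
    | cast s => intro hs; simpa using h s (by simpa using hs)

lemma isOverallBest_appendRank_last {n : ℕ} (p : Fin (n + 1)) (σ : Equiv.Perm (Fin n)) :
    IsOverallBest (appendRank p σ) (Fin.last n) ↔ p = Fin.last n := by
  constructor
  · intro h
    simpa [Fin.last_le_iff] using h ((appendRank p σ).symm (Fin.last n))
  · rintro rfl s
    simpa using Fin.le_last _

lemma isRecord_last {n : ℕ} (σ : Equiv.Perm (Fin (n + 1))) :
    IsRecord σ (Fin.last n) ↔ IsOverallBest σ (Fin.last n) :=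
  ⟨fun h s => h s (Fin.le_last s), fun h s _ => h s⟩

lemma isOverallBest_appendRank_castSucc {n : ℕ} (p : Fin (n + 1)) (σ : Equiv.Perm (Fin n))
    (t : Fin n) :
    IsOverallBest (appendRank p σ) t.castSucc ↔ p ≠ Fin.last n ∧ IsOverallBest σ t := by
  constructor
  · intro h
    refine ⟨?_, fun s => by simpa using h s.castSucc⟩
    rintro rfl
    have := h (Fin.last n)
    simp [Fin.last_le_iff] at this
  · rintro ⟨hp, h⟩ s
    induction s using Fin.lastCases with
    | cast s => simpa using h s
    | last =>
      by_contra! hlt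
      simp only [appendRank_last, appendRank_castSucc] at hlt
      refine hp ((isOverallBest_appendRank_last p σ).1 fun s => ?_)
      induction s using Fin.lastCases with
      | last => exact le_rfl
      | cast s => simpa using (((Fin.strictMono_succAbove p).monotone (h s)).trans_lt hlt).le

lemma acceptProb_appendRank_castSucc (q : Strategy) {n : ℕ} (p : Fin (n + 1))
    (σ : Equiv.Perm (Fin n)) (t : Fin n) :
    acceptProb q (appendRank p σ) t.castSucc = acceptProb q σ t := by
  simp only [acceptProb, isRecord_appendRank_castSucc, Fin.val_castSucc]

lemma acceptProb_appendRank_last (q : Strategy) {n : ℕ} (p : Fin (n + 1))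
    (σ : Equiv.Perm (Fin n)) :
    acceptProb q (appendRank p σ) (Fin.last n) =
      if p = Fin.last n then (q n.succPNat : ℝ) else 0 := by
  simp only [acceptProb, isRecord_last, isOverallBest_appendRank_last, Fin.val_last]

lemma pickProb_appendRank_castSucc (q : Strategy) {n : ℕ} (p : Fin (n + 1))
    (σ : Equiv.Perm (Fin n)) (t : Fin n) :
    pickProb q (appendRank p σ) t.castSucc = pickProb q σ t := by
  simp only [pickProb, Finset.prod_filter, acceptProb_appendRank_castSucc, Fin.prod_univ_castSucc,
    Fin.castSucc_lt_castSucc_iff, (Fin.castSucc_lt_last t).not_gt, if_false, mul_one]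

lemma pickProb_last (q : Strategy) {n : ℕ} (p : Fin (n + 1)) (σ : Equiv.Perm (Fin n)) :
    pickProb q (appendRank p σ) (Fin.last n) =
      (∏ s, (1 - acceptProb q σ s)) * if p = Fin.last n then (q n.succPNat : ℝ) else 0 := by
  simp only [pickProb, Finset.prod_filter, Fin.prod_univ_castSucc, acceptProb_appendRank_castSucc,
    acceptProb_appendRank_last]
  simp [Fin.castSucc_lt_last]

/-- The probability that the strategy `q` accepts none of the first `n` candidates. -/
noncomputable def rejectProb (q : Strategy) (n : ℕ) : ℝ :=
  ∏ s ∈ Finset.range n, (1 - (q s.succPNat : ℝ) / (s + 1))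

lemma rejectProb_succ (q : Strategy) (n : ℕ) :
    rejectProb q (n + 1) = rejectProb q n * (1 - (q n.succPNat : ℝ) / (n + 1)) :=
  Finset.prod_range_succ _ _

/-- Records at different times are independent, and time `s + 1` is a record with probability `1 /
(s + 1)`. -/
lemma sum_prod_one_sub_acceptProb (q : Strategy) (n : ℕ) :
    ∑ σ : Equiv.Perm (Fin n), ∏ s, (1 - acceptProb q σ s) = n.factorial * rejectProb q n := by
  induction n with
  | zero => simp [rejectProb]
  | succ n ih =>
    have hsum : ∑ p : Fin (n + 1), (1 - if p = Fin.last n then (q n.succPNat : ℝ) else 0) =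
        n + 1 - q n.succPNat := by
      rw [Finset.sum_sub_distrib, Finset.sum_ite_eq' Finset.univ]
      simp
    rw [sum_perm_succ]
    simp only [Fin.prod_univ_castSucc, acceptProb_appendRank_castSucc, acceptProb_appendRank_last]
    simp only [← Finset.sum_mul]
    rw [← Finset.mul_sum, hsum, ih, rejectProb_succ, Nat.factorial_succ]
    push_cast
    field_simp

/-- With probability `1 / (n + 1)` the last candidate is the best and must be reached and accepted;
otherwise it is irrelevant and the game is the one with `n` candidates. -/
lemma winProb_succ (q : Strategy) (n : ℕ) :
    (n + 1 : ℝ) * winProb q (n + 1) = n * winProb q n + q n.succPNat * rejectProb q n := by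
  have key : ∑ τ : Equiv.Perm (Fin (n + 1)), ∑ t,
      (if IsOverallBest τ t then pickProb q τ t else 0) =
      n * (∑ σ : Equiv.Perm (Fin n), ∑ t, if IsOverallBest σ t then pickProb q σ t else 0) +
        q n.succPNat * (n.factorial * rejectProb q n) := by
    rw [sum_perm_succ, Fin.sum_univ_castSucc (n := n), ← sum_prod_one_sub_acceptProb]
    congr 1
    · have : ∀ p : Fin n, ∑ σ : Equiv.Perm (Fin n), ∑ t,
          (if IsOverallBest (appendRank p.castSucc σ) t then
            pickProb q (appendRank p.castSucc σ) t else 0) =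
          ∑ σ : Equiv.Perm (Fin n), ∑ t, if IsOverallBest σ t then pickProb q σ t else 0 := by
        intro p
        refine Finset.sum_congr rfl fun σ _ => ?_
        rw [Fin.sum_univ_castSucc]
        simp only [isOverallBest_appendRank_castSucc, pickProb_appendRank_castSucc,
          isOverallBest_appendRank_last, Fin.castSucc_ne_last]
        simp
      rw [Finset.sum_congr rfl fun p _ => this p]
      simp
    · rw [Finset.mul_sum]
      refine Finset.sum_congr rfl fun σ _ => ?_
      rw [Fin.sum_univ_castSucc]
      simp only [isOverallBest_appendRank_castSucc, isOverallBest_appendRank_last, pickProb_last]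
      simp [mul_comm]
  have hf : (n.factorial : ℝ) ≠ 0 := by positivity
  rw [winProb, winProb, key, Nat.factorial_succ]
  push_cast
  field_simp

lemma rejectProb_nonneg (q : Strategy) (n : ℕ) : 0 ≤ rejectProb q n := by
  refine Finset.prod_nonneg fun s _ => ?_
  have h1 := (q s.succPNat).2.2
  rw [sub_nonneg, div_le_one (by positivity)]
  have : (0 : ℝ) ≤ s := by positivity
  linarith

lemma winProb_one (q : Strategy) : winProb q 1 = q 1 := by
  have h1 : Nat.succPNat 0 = 1 := rfl
  simpa [rejectProb, h1] using winProb_succ q 0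

/-- The part of the success probability that depends on the first acceptance probability. -/
lemma winProb_eq_update (q : Strategy) {n : ℕ} (hn : 1 ≤ n) :
    (n : ℝ) * winProb q n =
      q 1 + (1 - q 1) * (n * winProb (Function.update q 1 0) n) := by
  have hq : ∀ k : ℕ, 1 ≤ k → Function.update q 1 0 k.succPNat = q k.succPNat := by
    intro k hk
    refine Function.update_of_ne (fun h => ?_) _ _
    have := congrArg PNat.val h
    simp at this
    omega
  have hr : ∀ k : ℕ, 1 ≤ k →
      rejectProb q k = (1 - q 1) * rejectProb (Function.update q 1 0) k := by
    intro k hk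
    induction k, hk using Nat.le_induction with
    | base =>
      have h1 : Nat.succPNat 0 = 1 := rfl
      simp [rejectProb, h1]
    | succ k hk ih => rw [rejectProb_succ, rejectProb_succ, ih, hq k hk]; ring
  induction n, hn using Nat.le_induction with
  | base => simp [winProb_one]
  | succ k hk ih =>
    push_cast
    rw [winProb_succ, winProb_succ, ih, hr k hk, hq k hk]
    ring

end RandomHorizonSecretary

/-! ### Value of the game after rejecting the first candidate, and its limit -/

namespace RandomHorizonSecretary

lemma rejectProb_le_one (q : Strategy) (n : ℕ) : rejectProb q n ≤ 1 := by
  induction n with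
  | zero => simp [rejectProb]
  | succ n ih =>
    rw [rejectProb_succ]
    have h0 := (q n.succPNat).2.1
    have h1 : (0 : ℝ) ≤ (q n.succPNat : ℝ) / (n + 1) := by positivity
    nlinarith [rejectProb_nonneg q n]

lemma winProb_le_one_sub_rejectProb (q : Strategy) (n : ℕ) :
    (n : ℝ) * winProb q n ≤ n * (1 - rejectProb q n) := by
  induction n with
  | zero => simp
  | succ n ih =>
    have h : ((n : ℝ) + 1) * rejectProb q (n + 1) = (n + 1 - q n.succPNat) * rejectProb q n := by
      rw [rejectProb_succ]
      field_simp
    push_cast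
    rw [winProb_succ, mul_sub, h]
    nlinarith [rejectProb_le_one q n]

/-- The sum `1/r + ⋯ + 1/(n-1)`. -/
noncomputable def harmonicTail (r n : ℕ) : ℝ := ∑ j ∈ Finset.Ico r n, (1 : ℝ) / j

lemma harmonicTail_self (n : ℕ) : harmonicTail n n = 0 := by simp [harmonicTail]

lemma harmonicTail_nonneg (r n : ℕ) : 0 ≤ harmonicTail r n :=
  Finset.sum_nonneg fun _ _ => by positivity

lemma harmonicTail_succ_right {r n : ℕ} (h : r ≤ n) :
    harmonicTail r (n + 1) = harmonicTail r n + 1 / n :=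
  Finset.sum_Ico_succ_top h _

lemma harmonicTail_eq_add {r n : ℕ} (h : r < n) :
    harmonicTail r n = 1 / r + harmonicTail (r + 1) n :=
  Finset.sum_eq_sum_Ico_succ_bot h _

/-- Backward induction: once the harmonic tail is at most `1`, accepting every record is optimal. In
each step the loss from a smaller `q` is `(1 - q) * (1 - harmonicTail (t + 1) n)` times the
probability of still running. -/
lemma winProb_sub_le (q : Strategy) {r n t : ℕ} (hr : 1 ≤ r) (hT : harmonicTail r n ≤ 1)
    (hrt : r ≤ t) (htn : t ≤ n) :
    (n : ℝ) * winProb q n - t * winProb q t ≤ rejectProb q t * (t * harmonicTail t n) ∧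
      harmonicTail t n ≤ 1 := by
  induction htn using Nat.decreasingInduction with
  | self => simp [harmonicTail_self]
  | of_succ t htn ih =>
    have hT' : harmonicTail t n ≤ 1 := by
      refine le_trans (Finset.sum_le_sum_of_subset_of_nonneg ?_ fun _ _ _ => by positivity) hT
      exact Finset.Ico_subset_Ico_left hrt
    refine ⟨?_, hT'⟩
    obtain ⟨h1, h2⟩ := ih (by omega)
    have ht : (0 : ℝ) < t := by exact_mod_cast (by omega : 0 < t)
    push_cast at h1
    rw [winProb_succ, rejectProb_succ] at h1
    have e1 : rejectProb q t * (1 - (q t.succPNat : ℝ) / (t + 1)) *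
        (((t : ℝ) + 1) * harmonicTail (t + 1) n) =
        rejectProb q t * ((t + 1 - q t.succPNat) * harmonicTail (t + 1) n) := by
      field_simp
    have e2 : (t : ℝ) * harmonicTail t n = 1 + t * harmonicTail (t + 1) n := by
      rw [harmonicTail_eq_add (by omega)]
      field_simp
    rw [e1] at h1
    rw [e2]
    have h3 : 0 ≤ (1 - (q t.succPNat : ℝ)) * (1 - harmonicTail (t + 1) n) :=
      mul_nonneg (sub_nonneg.2 (q t.succPNat).2.2) (sub_nonneg.2 h2)
    nlinarith [mul_nonneg (rejectProb_nonneg q t) h3]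

/-- With `R` the probability of reaching time `r` without acceptance, the part before `r`
contributes at most `r * (1 - R)` and the part after it at most `r * R`. -/
lemma mul_winProb_le (q : Strategy) {r n : ℕ} (hr : 1 ≤ r) (hT : harmonicTail r n ≤ 1) :
    (n : ℝ) * winProb q n ≤ r := by
  rcases le_total n r with h | h
  · have h1 := winProb_le_one_sub_rejectProb q n
    have h2 : (n : ℝ) ≤ r := by exact_mod_cast h
    have h3 : 0 ≤ (n : ℝ) * rejectProb q n := mul_nonneg n.cast_nonneg (rejectProb_nonneg q n)
    linarith
  · have h1 := (winProb_sub_le q hr hT le_rfl h).1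
    have h2 := winProb_le_one_sub_rejectProb q r
    have h3 := mul_nonneg (mul_nonneg (rejectProb_nonneg q r) (Nat.cast_nonneg r))
      (sub_nonneg.2 hT)
    linarith

/-- The strategy that rejects the first `r` candidates and accepts the next record. -/
noncomputable def thresholdStrategy (r : ℕ) : Strategy := fun t => if r < t then 1 else 0

lemma thresholdStrategy_succPNat (r k : ℕ) :
    (thresholdStrategy r k.succPNat : ℝ) = if r ≤ k then 1 else 0 := by
  simp only [thresholdStrategy, Nat.succPNat_coe, Nat.lt_succ_iff]
  split_ifs <;> simp

lemma thresholdStrategy_one {r : ℕ} (hr : 1 ≤ r) : thresholdStrategy r 1 = 0 :=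
  if_neg (by rw [PNat.one_coe]; omega)

lemma winProb_thresholdStrategy {r n : ℕ} (hr : 1 ≤ r) (h : r ≤ n) :
    (n : ℝ) * winProb (thresholdStrategy r) n = r * harmonicTail r n := by
  have before : ∀ k, k ≤ r → (k : ℝ) * winProb (thresholdStrategy r) k = 0 ∧
      rejectProb (thresholdStrategy r) k = 1 := by
    intro k
    induction k with
    | zero => simp [rejectProb]
    | succ k ih =>
      intro hk
      push_cast
      rw [winProb_succ, rejectProb_succ, thresholdStrategy_succPNat, if_neg (by omega)]
      simp [ih (by omega)]
  have after : (n : ℝ) * winProb (thresholdStrategy r) n = r * harmonicTail r n ∧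
      rejectProb (thresholdStrategy r) n = r / n := by
    have hr0 : (0 : ℝ) < r := by exact_mod_cast hr
    induction n, h using Nat.le_induction with
    | base => simp [before r le_rfl, harmonicTail_self, hr0.ne']
    | succ k hk ih =>
      have hk0 : (0 : ℝ) < k := hr0.trans_le (by exact_mod_cast hk)
      push_cast
      rw [winProb_succ, rejectProb_succ, thresholdStrategy_succPNat, if_pos hk, ih.1, ih.2,
        harmonicTail_succ_right hk]
      constructor
      · ring
      · field_simp
        ring
  exact after.1

/-- The best probability of picking the best of `n` candidates when the first one is rejected. -/
noncomputable def skipValue (n : ℕ) : ℝ := sSup ((fun q => winProb q n) '' {q | q 1 = 0})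

lemma winProb_le_skipValue {n : ℕ} (hn : 1 ≤ n) {q : Strategy} (hq : q 1 = 0) :
    winProb q n ≤ skipValue n := by
  refine le_csSup ⟨1, ?_⟩ ⟨q, hq, rfl⟩
  rintro _ ⟨q, -, rfl⟩
  have hn0 : (0 : ℝ) < n := by exact_mod_cast hn
  -- Taking `r = n`, where the tail is empty, gives the bound `1` that makes the supremum
  -- meaningful.
  have h := mul_winProb_le q hn (n := n) (by rw [harmonicTail_self]; exact zero_le_one)
  exact le_of_mul_le_mul_left (h.trans_eq (mul_one _).symm) hn0

lemma skipValue_le {n : ℕ} {B : ℝ} (h : ∀ q : Strategy, q 1 = 0 → winProb q n ≤ B) :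
    skipValue n ≤ B := by
  refine csSup_le ⟨_, ⟨fun _ => 0, rfl, rfl⟩⟩ ?_
  rintro _ ⟨q, hq, rfl⟩
  exact h q hq

lemma skipValue_le_div {r n : ℕ} (hn : 1 ≤ n) (hr : 1 ≤ r) (hT : harmonicTail r n ≤ 1) :
    skipValue n ≤ r / n := by
  have hn0 : (0 : ℝ) < n := by exact_mod_cast hn
  refine skipValue_le fun q _ => ?_
  rw [le_div_iff₀ hn0, mul_comm]
  exact mul_winProb_le q hr hT

lemma div_mul_harmonicTail_le_skipValue {r n : ℕ} (hr : 1 ≤ r) (h : r ≤ n) :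
    r / n * harmonicTail r n ≤ skipValue n := by
  have hn0 : (0 : ℝ) < n := by exact_mod_cast hr.trans h
  refine le_trans (le_of_eq ?_)
    (winProb_le_skipValue (hr.trans h) (thresholdStrategy_one hr))
  rw [div_mul_eq_mul_div, ← winProb_thresholdStrategy hr h]
  field_simp

lemma one_div_lt_skipValue {n : ℕ} (hn : 3 ≤ n) : 1 / (n : ℝ) < skipValue n := by
  have hn0 : (0 : ℝ) < n := by exact_mod_cast (by omega : 0 < n)
  -- Here `3 ≤ n` is needed: the tail then contains `1 + 1/2`.
  have hT : 1 < harmonicTail 1 n := by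
    rw [harmonicTail_eq_add (by omega), harmonicTail_eq_add (by omega)]
    have := harmonicTail_nonneg (1 + 1 + 1) n
    norm_num at this ⊢
    linarith
  refine lt_of_lt_of_le ?_ (div_mul_harmonicTail_le_skipValue le_rfl (by omega))
  have : (0 : ℝ) < 1 / n := by positivity
  push_cast
  nlinarith

/-- With `r = ⌈n/2⌉` the tail has at most `r` terms, each at most `1 / r`. The bound yields
`criticalWeight n ≤ 1/3`. -/
lemma skipValue_sub_le_half {n : ℕ} (hn : 1 ≤ n) : skipValue n - 1 / n ≤ 1 / 2 := by
  have hn0 : (0 : ℝ) < n := by exact_mod_cast hn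
  set r := (n + 1) / 2 with hr
  have hr1 : 1 ≤ r := by omega
  have hr0 : (0 : ℝ) < r := by exact_mod_cast hr1
  have hT : harmonicTail r n ≤ 1 := by
    have h1 : harmonicTail r n ≤ ∑ _j ∈ Finset.Ico r n, (1 : ℝ) / r := by
      refine Finset.sum_le_sum fun j hj => ?_
      have : (r : ℝ) ≤ j := by exact_mod_cast (Finset.mem_Ico.1 hj).1
      gcongr
    refine h1.trans ?_
    rw [Finset.sum_const, Nat.card_Ico, nsmul_eq_mul, mul_one_div, div_le_one hr0]
    exact_mod_cast (by omega : n - r ≤ r)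
  have h := skipValue_le_div hn hr1 hT
  have h2 : (r : ℝ) ≤ (n + 1) / 2 := by
    rw [le_div_iff₀ two_pos]
    exact_mod_cast (by omega : r * 2 ≤ n + 1)
  have h3 : (r : ℝ) / n ≤ 1 / 2 + 1 / n := by
    rw [div_le_iff₀ hn0]
    field_simp
    linarith
  linarith

lemma log_div_le_harmonicTail {r n : ℕ} (hr : 1 ≤ r) (h : r ≤ n) :
    Real.log (n / r) ≤ harmonicTail r n := by
  have hr0 : (0 : ℝ) < r := by exact_mod_cast hr
  induction n, h using Nat.le_induction with
  | base => simp [harmonicTail_self, hr0.ne']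
  | succ n hn ih =>
    have hn0 : (0 : ℝ) < n := hr0.trans_le (by exact_mod_cast hn)
    have h1 := Real.log_le_sub_one_of_pos (x := ((n : ℝ) + 1) / n) (by positivity)
    have h2 : ((n : ℝ) + 1) / n - 1 = 1 / n := by field_simp; ring
    rw [harmonicTail_succ_right hn]
    push_cast
    rw [Real.log_div hn0.ne' hr0.ne'] at ih
    rw [Real.log_div (by positivity) hn0.ne'] at h1
    rw [Real.log_div (by positivity) hr0.ne']
    linarith

lemma harmonicTail_succ_le_log_div {s n : ℕ} (hs : 1 ≤ s) (h : s ≤ n) :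
    harmonicTail (s + 1) (n + 1) ≤ Real.log (n / s) := by
  have hs0 : (0 : ℝ) < s := by exact_mod_cast hs
  induction n, h using Nat.le_induction with
  | base => simp [harmonicTail_self, hs0.ne']
  | succ n hn ih =>
    have hn0 : (0 : ℝ) < n := hs0.trans_le (by exact_mod_cast hn)
    have h1 := Real.one_sub_inv_le_log_of_pos (x := ((n : ℝ) + 1) / n) (by positivity)
    have h2 : 1 - (((n : ℝ) + 1) / n)⁻¹ = 1 / (n + 1) := by field_simp; ring
    rw [harmonicTail_succ_right (by omega)]
    push_cast
    rw [Real.log_div hn0.ne' hs0.ne'] at ih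
    rw [Real.log_div (by positivity) hn0.ne'] at h1
    rw [Real.log_div (by positivity) hs0.ne']
    linarith

/-- With `s = ⌈n/e⌉`, the threshold strategy at `s` gives the lower bound `(s/n) log (n/s)`, and `r
= s + 1`, whose tail is at most `log (n/s) ≤ 1`, gives the upper bound `(s + 1)/n`. -/
lemma tendsto_skipValue : Tendsto skipValue atTop (𝓝 (Real.exp 1)⁻¹) := by
  have he : (0 : ℝ) < (Real.exp 1)⁻¹ := by positivity
  have he1 : (Real.exp 1)⁻¹ ≤ 1 := inv_le_one_of_one_le₀ (Real.one_le_exp zero_le_one)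
  have hlim : Tendsto (fun n : ℕ => (⌈(Real.exp 1)⁻¹ * (n : ℝ)⌉₊ : ℝ) / n) atTop
      (𝓝 (Real.exp 1)⁻¹) :=
    (tendsto_nat_ceil_mul_div_atTop he.le).comp tendsto_natCast_atTop_atTop
  have hlower : Tendsto
      (fun n : ℕ => Real.negMulLog ((⌈(Real.exp 1)⁻¹ * (n : ℝ)⌉₊ : ℝ) / n)) atTop
      (𝓝 (Real.exp 1)⁻¹) := by
    have := (Real.continuous_negMulLog.tendsto (Real.exp 1)⁻¹).comp hlim
    rwa [Real.negMulLog, Real.log_inv, Real.log_exp, neg_mul_neg, mul_one] at this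
  have hupper : Tendsto
      (fun n : ℕ => (⌈(Real.exp 1)⁻¹ * (n : ℝ)⌉₊ : ℝ) / n + 1 / n) atTop
      (𝓝 (Real.exp 1)⁻¹) := by
    simpa using hlim.add tendsto_one_div_atTop_nhds_zero_nat
  refine tendsto_of_tendsto_of_tendsto_of_le_of_le' hlower hupper ?_ ?_
  all_goals
    filter_upwards [eventually_ge_atTop 1] with n hn
    have hn0 : (0 : ℝ) < n := by exact_mod_cast hn
    have hs : 1 ≤ ⌈(Real.exp 1)⁻¹ * (n : ℝ)⌉₊ := Nat.one_le_ceil_iff.2 (by positivity)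
    have hsn : ⌈(Real.exp 1)⁻¹ * (n : ℝ)⌉₊ ≤ n := Nat.ceil_le.2 (by nlinarith)
    have hle := Nat.le_ceil ((Real.exp 1)⁻¹ * (n : ℝ))
    generalize ⌈(Real.exp 1)⁻¹ * (n : ℝ)⌉₊ = s at *
    have hs0 : (0 : ℝ) < s := by exact_mod_cast hs
  · refine le_trans ?_ (div_mul_harmonicTail_le_skipValue hs hsn)
    rw [Real.negMulLog, neg_mul, ← mul_neg, ← Real.log_inv, inv_div]
    exact mul_le_mul_of_nonneg_left (log_div_le_harmonicTail hs hsn) (by positivity)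
  · have hT : harmonicTail (s + 1) n ≤ 1 := by
      have h1 : harmonicTail (s + 1) n ≤ harmonicTail (s + 1) (n + 1) :=
        Finset.sum_le_sum_of_subset_of_nonneg
          (Finset.Ico_subset_Ico_right (Nat.le_succ n)) fun _ _ _ => by positivity
      refine h1.trans ((harmonicTail_succ_le_log_div hs hsn).trans ?_)
      rw [Real.log_le_iff_le_exp (by positivity), div_le_iff₀ hs0]
      rwa [inv_mul_le_iff₀ (Real.exp_pos 1)] at hle
    refine (skipValue_le_div hn (by omega) hT).trans (le_of_eq ?_)
    push_cast
    ring

end RandomHorizonSecretary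

/-! ### Hypothesis testing by Hellinger affinity -/

/-- If a test distinguishes two finite distributions with both error probabilities at most `1/3`,
then the squared Hellinger affinity is at most `8/9`. -/
lemma sq_sum_sqrt_mul_le {X : Type*} [Fintype X] {P Q f : X → ℝ} (hP : ∀ x, 0 ≤ P x)
    (hQ : ∀ x, 0 ≤ Q x) (hf0 : ∀ x, 0 ≤ f x) (hf1 : ∀ x, f x ≤ 1) (sP : ∑ x, P x = 1)
    (sQ : ∑ x, Q x = 1) (h1 : 2 / 3 ≤ ∑ x, P x * f x) (h2 : 2 / 3 ≤ ∑ x, Q x * (1 - f x)) :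
    (∑ x, √(P x * Q x)) ^ 2 ≤ 8 / 9 := by
  have hsplit : ∀ x, √(P x * Q x) =
      √(P x * f x) * √(Q x * f x) + √(P x * (1 - f x)) * √(Q x * (1 - f x)) := by
    intro x
    have h1f := sub_nonneg.2 (hf1 x)
    rw [Real.sqrt_mul (hP x), Real.sqrt_mul (hP x), Real.sqrt_mul (hQ x), Real.sqrt_mul (hP x),
      Real.sqrt_mul (hQ x)]
    linear_combination -(√(P x) * √(Q x)) * (Real.mul_self_sqrt (hf0 x)) -
      (√(P x) * √(Q x)) * (Real.mul_self_sqrt h1f)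
  have hP' : ∑ x, P x * (1 - f x) = 1 - ∑ x, P x * f x := by
    simp only [mul_sub, mul_one, Finset.sum_sub_distrib, sP]
  have hQ' : ∑ x, Q x * (1 - f x) = 1 - ∑ x, Q x * f x := by
    simp only [mul_sub, mul_one, Finset.sum_sub_distrib, sQ]
  -- Data processing: Cauchy–Schwarz on each outcome of the test bounds the affinity by that of the
  -- two outcome laws.
  have hle : ∑ x, √(P x * Q x) ≤
      √(∑ x, P x * f x) * √(∑ x, Q x * f x) +
        √(∑ x, P x * (1 - f x)) * √(∑ x, Q x * (1 - f x)) := by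
    rw [Finset.sum_congr rfl fun x _ => hsplit x, Finset.sum_add_distrib]
    refine add_le_add ?_ ?_
    · exact Real.sum_sqrt_mul_sqrt_le _ (fun x => mul_nonneg (hP x) (hf0 x))
        (fun x => mul_nonneg (hQ x) (hf0 x))
    · exact Real.sum_sqrt_mul_sqrt_le _ (fun x => mul_nonneg (hP x) (sub_nonneg.2 (hf1 x)))
        (fun x => mul_nonneg (hQ x) (sub_nonneg.2 (hf1 x)))
  have hu1 : 0 ≤ ∑ x, P x * (1 - f x) :=
    Finset.sum_nonneg fun x _ => mul_nonneg (hP x) (sub_nonneg.2 (hf1 x))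
  have hv0 : 0 ≤ ∑ x, Q x * f x := Finset.sum_nonneg fun x _ => mul_nonneg (hQ x) (hf0 x)
  have hv1 : 0 ≤ ∑ x, Q x * (1 - f x) := by linarith
  have h0 : 0 ≤ ∑ x, √(P x * Q x) := Finset.sum_nonneg fun x _ => Real.sqrt_nonneg _
  rw [hP'] at hle hu1
  rw [hQ'] at hle h2 hv1
  generalize ∑ x, √(P x * Q x) = B at *
  generalize ∑ x, P x * f x = u at *
  generalize ∑ x, Q x * f x = v at *
  have hu0 : 0 ≤ u := by linarith
  have hα : 2 / 3 ≤ √u * √(1 - v) := by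
    rw [← Real.sqrt_mul hu0]
    exact Real.le_sqrt_of_sq_le (by nlinarith)
  have hβ : √v * √(1 - u) ≤ 1 / 3 := by
    rw [← Real.sqrt_mul hv0]
    exact Real.sqrt_le_iff.2 ⟨by norm_num, by nlinarith⟩
  -- Lagrange's identity; the second square is at least `(2/3 - 1/3)² = 1/9`.
  have hid : (√u * √v + √(1 - u) * √(1 - v)) ^ 2 +
      (√u * √(1 - v) - √v * √(1 - u)) ^ 2 = 1 := by
    have e : (√u * √v + √(1 - u) * √(1 - v)) ^ 2 + (√u * √(1 - v) - √v * √(1 - u)) ^ 2 =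
        (√u ^ 2 + √(1 - u) ^ 2) * (√v ^ 2 + √(1 - v) ^ 2) := by ring
    rw [e, Real.sq_sqrt hu0, Real.sq_sqrt hv0, Real.sq_sqrt hu1, Real.sq_sqrt hv1]
    ring
  have hB : B ^ 2 ≤ (√u * √v + √(1 - u) * √(1 - v)) ^ 2 := pow_le_pow_left₀ h0 hle 2
  nlinarith

lemma sqrt_finset_prod {ι : Type*} (s : Finset ι) {f : ι → ℝ} (hf : ∀ i, 0 ≤ f i) :
    √(∏ i ∈ s, f i) = ∏ i ∈ s, √(f i) := by
  rw [Real.sqrt_eq_iff_eq_sq (Finset.prod_nonneg fun i _ => hf i)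
    (Finset.prod_nonneg fun i _ => Real.sqrt_nonneg _), ← Finset.prod_pow]
  exact Finset.prod_congr rfl fun i _ => (Real.sq_sqrt (hf i)).symm

/-- A test based on `m` independent samples that distinguishes `P` from `Q` with both error
probabilities at most `1/3` needs a number of samples inversely proportional to
`1 - (∑ √(P Q))²`. -/
lemma one_le_nine_mul_of_test {X : Type*} [Fintype X] {P Q : X → ℝ} (hP : ∀ x, 0 ≤ P x)
    (hQ : ∀ x, 0 ≤ Q x) (sP : ∑ x, P x = 1) (sQ : ∑ x, Q x = 1) {m : ℕ}
    {f : (Fin m → X) → ℝ} (hf0 : ∀ x, 0 ≤ f x) (hf1 : ∀ x, f x ≤ 1)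
    (h1 : 2 / 3 ≤ ∑ x, (∏ i, P (x i)) * f x) (h2 : 2 / 3 ≤ ∑ x, (∏ i, Q (x i)) * (1 - f x)) :
    1 ≤ 9 * m * (1 - (∑ x, √(P x * Q x)) ^ 2) := by
  have h := sq_sum_sqrt_mul_le (fun x : Fin m → X => Finset.prod_nonneg fun i _ => hP (x i))
    (fun x => Finset.prod_nonneg fun i _ => hQ (x i)) hf0 hf1
    (by rw [← Fintype.sum_pow, sP, one_pow]) (by rw [← Fintype.sum_pow, sQ, one_pow]) h1 h2
  have e : ∑ x : Fin m → X, √((∏ i, P (x i)) * ∏ i, Q (x i)) = (∑ x, √(P x * Q x)) ^ m := by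
    rw [Fintype.sum_pow]
    refine Finset.sum_congr rfl fun x _ => ?_
    rw [← Finset.prod_mul_distrib, sqrt_finset_prod _ fun i => mul_nonneg (hP _) (hQ _)]
  rw [e, ← pow_mul, mul_comm m 2, pow_mul] at h
  -- Bernoulli's inequality: `1 - m (1 - ρ²) ≤ ρ ^ (2m) ≤ 8/9`.
  have hb := one_add_mul_le_pow (a := (∑ x, √(P x * Q x)) ^ 2 - 1)
    (by linarith [sq_nonneg (∑ x, √(P x * Q x))]) m
  rw [add_sub_cancel] at hb
  linarith

/-- The weights of the Bernoulli law with parameter `a`. -/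
def bernoulliWeight (a : ℝ) (b : Bool) : ℝ := cond b a (1 - a)

lemma bernoulliWeight_nonneg {a : ℝ} (ha : a ∈ Set.Icc (0 : ℝ) 1) (b : Bool) :
    0 ≤ bernoulliWeight a b := by
  cases b
  · exact sub_nonneg.2 ha.2
  · exact ha.1

lemma sum_bernoulliWeight (a : ℝ) : ∑ b, bernoulliWeight a b = 1 := by
  simp [bernoulliWeight]

/-- For parameters `a`, `b`, put `α = √(a(1-b))` and `β = √(b(1-a))`. Then `1 - ρ² = (α - β)²` and
`(α - β)(α + β) = a - b = 4ε/3`, so a lower bound on `α + β` suffices. -/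
lemma mul_one_sub_sq_affinity_bernoulliWeight_le {c ε : ℝ} (hε : 0 < ε) (hεc : ε < c)
    (hc : c ≤ 1 / 3) :
    (c - ε) * (1 - (∑ b, √(bernoulliWeight (c + 2 * ε / 3) b *
      bernoulliWeight (c - 2 * ε / 3) b)) ^ 2) ≤ ε ^ 2 := by
  simp only [Fintype.sum_bool, bernoulliWeight, cond_true, cond_false]
  set a := c + 2 * ε / 3 with ha
  set b := c - 2 * ε / 3 with hb
  have ha0 : 0 ≤ a := by linarith
  have hb0 : 0 ≤ b := by linarith
  have ha1 : 0 ≤ 1 - a := by linarith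
  have hb1 : 0 ≤ 1 - b := by linarith
  rw [Real.sqrt_mul ha0, Real.sqrt_mul ha1]
  obtain ⟨α, hα⟩ : ∃ α, α = √a * √(1 - b) := ⟨_, rfl⟩
  obtain ⟨β, hβ⟩ : ∃ β, β = √b * √(1 - a) := ⟨_, rfl⟩
  have hβ0 : 0 ≤ β := hβ ▸ by positivity
  have hα2 : α ^ 2 = a * (1 - b) := by rw [hα, mul_pow, Real.sq_sqrt ha0, Real.sq_sqrt hb1]
  have hβ2 : β ^ 2 = b * (1 - a) := by rw [hβ, mul_pow, Real.sq_sqrt hb0, Real.sq_sqrt ha1]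
  have hx : 1 - (√a * √b + √(1 - a) * √(1 - b)) ^ 2 = (α - β) ^ 2 := by
    have e : (√a * √b + √(1 - a) * √(1 - b)) ^ 2 + (α - β) ^ 2 =
        (√a ^ 2 + √(1 - a) ^ 2) * (√b ^ 2 + √(1 - b) ^ 2) := by rw [hα, hβ]; ring
    rw [Real.sq_sqrt ha0, Real.sq_sqrt hb0, Real.sq_sqrt ha1, Real.sq_sqrt hb1] at e
    linarith
  have hβα : β ≤ α := by
    rw [hα, hβ]
    exact mul_le_mul (Real.sqrt_le_sqrt (by linarith)) (Real.sqrt_le_sqrt (by linarith))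
      (Real.sqrt_nonneg _) (Real.sqrt_nonneg _)
  have hprod : (α - β) * (α + β) = 4 * ε / 3 := by
    have : (α - β) * (α + β) = α ^ 2 - β ^ 2 := by ring
    rw [this, hα2, hβ2, ha, hb]
    ring
  -- The constant is a lower bound for `1 - a`, as `a < 5c/3 ≤ 5/9`.
  have hαβ : (c - ε) * (4 / 9) ≤ α * β := by
    have h1 : β ^ 2 ≤ α * β := by nlinarith
    refine le_trans ?_ h1
    rw [hβ2]
    exact mul_le_mul (by linarith) (by linarith) (by norm_num) hb0
  have hsum : 16 / 9 * (c - ε) ≤ (α + β) ^ 2 := by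
    have e : (α + β) ^ 2 = α ^ 2 + β ^ 2 + 2 * (α * β) := by ring
    have e2 : α ^ 2 + β ^ 2 = 2 * c * (1 - c) + 8 / 9 * ε ^ 2 := by
      rw [hα2, hβ2, ha, hb]; ring
    have : c * (2 / 3) ≤ c * (1 - c) := mul_le_mul_of_nonneg_left (by linarith) (by linarith)
    rw [e, e2]
    nlinarith
  rw [hx]
  have h3 : 16 / 9 * (c - ε) * (α - β) ^ 2 ≤ (4 * ε / 3) ^ 2 := by
    rw [← hprod, mul_pow, mul_comm ((α - β) ^ 2)]
    exact mul_le_mul_of_nonneg_right hsum (sq_nonneg _)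
  linarith

/-! ### Laws on two points and samples from them -/

namespace RandomHorizonSecretary

/-- The law of the number of candidates that is `1` with probability `a` and `n` otherwise. -/
noncomputable def twoPointLaw (a : ℝ) (ha : a ∈ Set.Icc (0 : ℝ) 1) (n : ℕ+) : PMF ℕ+ :=
  (PMF.ofFintype (fun b => ENNReal.ofReal (bernoulliWeight a b)) (by
    rw [← ENNReal.ofReal_sum_of_nonneg fun b _ => bernoulliWeight_nonneg ha b,
      sum_bernoulliWeight, ENNReal.ofReal_one])).map fun b => cond b 1 n

lemma twoPointLaw_apply {a : ℝ} (ha : a ∈ Set.Icc (0 : ℝ) 1) (n k : ℕ+) :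
    twoPointLaw a ha n k =
      (if k = 1 then ENNReal.ofReal a else 0) + if k = n then ENNReal.ofReal (1 - a) else 0 := by
  simp [twoPointLaw, PMF.map_apply, tsum_fintype, bernoulliWeight]

lemma eq_or_eq_of_twoPointLaw_ne_zero {a : ℝ} (ha : a ∈ Set.Icc (0 : ℝ) 1) {n k : ℕ+}
    (h : twoPointLaw a ha n k ≠ 0) : k = 1 ∨ k = n := by
  by_contra! hk
  simp [twoPointLaw_apply, hk.1, hk.2] at h

lemma successProb_twoPointLaw {a : ℝ} (ha : a ∈ Set.Icc (0 : ℝ) 1) {n : ℕ+} (hn : n ≠ 1)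
    (q : Strategy) :
    successProb (twoPointLaw a ha n) q = a * q 1 + (1 - a) * winProb q n := by
  rw [successProb, tsum_eq_sum (s := {1, n}), Finset.sum_pair hn.symm]
  · simp [twoPointLaw_apply, hn, hn.symm, winProb_one, ENNReal.toReal_ofReal ha.1,
      ENNReal.toReal_ofReal (sub_nonneg.2 ha.2)]
  · intro k hk
    simp only [Finset.mem_insert, Finset.mem_singleton, not_or] at hk
    simp [twoPointLaw_apply, hk.1, hk.2]

/-- The samples are images of Bernoulli bits, so the algorithm becomes a randomized test on `Fin m →
Bool`. -/
lemma bind_pi_twoPointLaw_apply {a : ℝ} (ha : a ∈ Set.Icc (0 : ℝ) 1) (n : ℕ+) {m : ℕ}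
    (alg : Kernel (Fin m → ℕ+) Strategy) [IsMarkovKernel alg] {E : Set Strategy}
    (hE : MeasurableSet E) :
    (((Measure.pi fun _ : Fin m => (twoPointLaw a ha n).toMeasure).bind alg) E).toReal =
      ∑ x : Fin m → Bool, (∏ i, bernoulliWeight a (x i)) *
        (alg fun i => cond (x i) 1 n).real E := by
  have hm : Measurable fun b : Bool => (cond b 1 n : ℕ+) := measurable_of_countable _
  rw [twoPointLaw, ← PMF.toMeasure_map _ _ hm, ← Measure.pi_map_pi fun _ => hm.aemeasurable,
    Measure.bind_apply hE alg.measurable.aemeasurable,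
    lintegral_map (alg.measurable_coe hE) (by fun_prop), lintegral_fintype,
    ENNReal.toReal_sum fun x _ => by finiteness]
  refine Finset.sum_congr rfl fun x _ => ?_
  rw [Measure.pi_singleton, ENNReal.toReal_mul, mul_comm, ENNReal.toReal_prod]
  congr 1
  refine Finset.prod_congr rfl fun i _ => ?_
  rw [PMF.toMeasure_apply_singleton _ _ (measurableSet_singleton _), PMF.ofFintype_apply,
    ENNReal.toReal_ofReal (bernoulliWeight_nonneg ha _)]

end RandomHorizonSecretary

/-! ### From suboptimality to a test, and the sample bound -/

namespace RandomHorizonSecretary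

lemma successProb_twoPointLaw_le {a : ℝ} (ha : a ∈ Set.Icc (0 : ℝ) 1) {n : ℕ+} (hn : n ≠ 1)
    (q : Strategy) :
    successProb (twoPointLaw a ha n) q ≤
      q 1 * (a + (1 - a) / (n : ℕ)) + (1 - q 1) * ((1 - a) * skipValue n) := by
  have hn0 : (0 : ℝ) < (n : ℕ) := by exact_mod_cast n.pos
  have h1 : winProb q n =
      q 1 / (n : ℕ) + (1 - q 1) * winProb (Function.update q 1 0) n := by
    have := winProb_eq_update q n.pos
    field_simp
    linarith
  have h2 : winProb (Function.update q 1 0) n ≤ skipValue n :=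
    winProb_le_skipValue n.pos (Function.update_self ..)
  have h3 := mul_le_mul_of_nonneg_left h2
    (mul_nonneg (sub_nonneg.2 ha.2) (sub_nonneg.2 (q 1).2.2))
  rw [successProb_twoPointLaw ha hn, h1]
  have e : (1 - a) * ((q 1 : ℝ) / (n : ℕ)) = q 1 * ((1 - a) / (n : ℕ)) := by ring
  linarith

lemma one_sub_mul_le_of_isSuboptimal {a η : ℝ} (ha : a ∈ Set.Icc (0 : ℝ) 1) {n : ℕ+} (hn : n ≠ 1)
    {q : Strategy} (h : IsSuboptimal (twoPointLaw a ha n) η q) :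
    (1 - q 1) * (a + (1 - a) / (n : ℕ) - (1 - a) * skipValue n) ≤ η := by
  have hn0 : (0 : ℝ) < (n : ℕ) := by exact_mod_cast n.pos
  -- The competitor that accepts the first candidate outright.
  have h1 := h fun _ => 1
  have h2 := successProb_twoPointLaw_le ha hn q
  have h3 : winProb (fun _ => 1) n = 1 / (n : ℕ) := by
    have := winProb_eq_update (fun _ => 1) n.pos
    simp only [Set.Icc.coe_one, sub_self, zero_mul, add_zero] at this
    field_simp
    linarith
  rw [successProb_twoPointLaw ha hn, h3, Set.Icc.coe_one] at h1
  have e : (1 - a) * (1 / ((n : ℕ) : ℝ)) = (1 - a) / (n : ℕ) := by ring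
  linarith

lemma mul_le_of_isSuboptimal {a η : ℝ} (ha : a ∈ Set.Icc (0 : ℝ) 1) (ha1 : a < 1) {n : ℕ+}
    (hn : n ≠ 1) {q : Strategy} (h : IsSuboptimal (twoPointLaw a ha n) η q) :
    q 1 * ((1 - a) * skipValue n - (a + (1 - a) / (n : ℕ))) ≤ η := by
  have ha' : 0 < 1 - a := sub_pos.2 ha1
  -- The competitors are all strategies with `q' 1 = 0`, so the supremum need not be attained.
  have h1 : skipValue n ≤ (successProb (twoPointLaw a ha n) q + η) / (1 - a) := by
    refine skipValue_le fun q' hq' => ?_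
    have := h q'
    rw [successProb_twoPointLaw ha hn q', hq', Set.Icc.coe_zero] at this
    rw [le_div_iff₀ ha']
    linarith
  rw [le_div_iff₀ ha'] at h1
  have h2 := successProb_twoPointLaw_le ha hn q
  linarith

/-- The strategies that accept the first candidate with probability more than `1/2`. -/
def likelyAcceptFirst : Set Strategy := {q | 1 / 2 < (q 1 : ℝ)}

lemma measurableSet_likelyAcceptFirst : MeasurableSet likelyAcceptFirst :=
  measurableSet_lt measurable_const (measurable_subtype_coe.comp (measurable_pi_apply 1))

/-- The weight of `1` at which accepting and rejecting the first candidate are equally good for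
laws on `{1, n}`. -/
noncomputable def criticalWeight (n : ℕ) : ℝ := 1 - 1 / (1 + (skipValue n - 1 / n))

lemma criticalWeight_mul {n : ℕ} (hn : 3 ≤ n) :
    criticalWeight n * (1 + (skipValue n - 1 / n)) = skipValue n - 1 / n := by
  have : 0 < 1 + (skipValue n - 1 / n) := by linarith [one_div_lt_skipValue hn]
  rw [criticalWeight, sub_mul, one_div_mul_cancel this.ne']
  ring

lemma criticalWeight_pos {n : ℕ} (hn : 3 ≤ n) : 0 < criticalWeight n := by
  have h := one_div_lt_skipValue hn
  have := one_div_lt_one_div_of_lt one_pos (by linarith : 1 < 1 + (skipValue n - 1 / n))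
  rw [criticalWeight]
  linarith

lemma criticalWeight_le {n : ℕ} (hn : 3 ≤ n) : criticalWeight n ≤ 1 / 3 := by
  have h := one_div_lt_skipValue hn
  have h2 := skipValue_sub_le_half (n := n) (by omega)
  have := one_div_le_one_div_of_le (by linarith)
    (by linarith : 1 + (skipValue n - 1 / n) ≤ 3 / 2)
  rw [criticalWeight]
  linarith

lemma tendsto_criticalWeight :
    Tendsto criticalWeight atTop (𝓝 (1 / (1 + Real.exp 1))) := by
  have he := Real.exp_pos 1
  have h : Tendsto (fun n : ℕ => 1 + (skipValue n - 1 / n)) atTop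
      (𝓝 (1 + ((Real.exp 1)⁻¹ - 0))) :=
    (tendsto_skipValue.sub tendsto_one_div_atTop_nhds_zero_nat).const_add 1
  have hne : 1 + ((Real.exp 1)⁻¹ - 0) ≠ 0 := by
    rw [sub_zero]
    positivity
  have h2 := ((tendsto_const_nhds (x := (1 : ℝ))).div h hne).const_sub 1
  convert! h2 using 2
  rw [sub_zero]
  generalize Real.exp 1 = x at he
  field_simp
  ring

lemma likelyAcceptFirst_of_isSuboptimal {n : ℕ+} (hn : 3 ≤ (n : ℕ)) {ε : ℝ} (hε : 0 < ε)
    (ha : criticalWeight n + 2 * ε / 3 ∈ Set.Icc (0 : ℝ) 1) {q : Strategy}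
    (h : IsSuboptimal (twoPointLaw _ ha n) (ε / 3) q) : q ∈ likelyAcceptFirst := by
  have hn1 : n ≠ 1 := by rintro rfl; simp at hn
  have h1 := one_sub_mul_le_of_isSuboptimal ha hn1 h
  have h2 := criticalWeight_mul hn
  have hD := one_div_lt_skipValue hn
  by_contra! hq
  have hq' : (q 1 : ℝ) ≤ 1 / 2 := not_lt.1 hq
  set D := skipValue n - 1 / (n : ℕ) with hDdef
  have e : criticalWeight n + 2 * ε / 3 + (1 - (criticalWeight n + 2 * ε / 3)) / (n : ℕ) -
      (1 - (criticalWeight n + 2 * ε / 3)) * skipValue n = 2 * ε / 3 * (1 + D) := by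
    linear_combination h2 + (criticalWeight n + 2 * ε / 3 - 1) * hDdef
  rw [e] at h1
  -- Strict positivity of `D` puts half of the gap `2ε/3 * (1 + D)` strictly above the tolerance
  -- `ε/3`.
  have hD0 : 0 < ε * D := mul_pos hε (by linarith)
  have h3 := mul_le_mul_of_nonneg_right (by linarith : 1 / 2 ≤ 1 - (q 1 : ℝ))
    (by linarith : 0 ≤ 2 * ε / 3 * (1 + D))
  linarith

lemma not_likelyAcceptFirst_of_isSuboptimal {n : ℕ+} (hn : 3 ≤ (n : ℕ)) {ε : ℝ} (hε : 0 < ε)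
    (ha : criticalWeight n - 2 * ε / 3 ∈ Set.Icc (0 : ℝ) 1) {q : Strategy}
    (h : IsSuboptimal (twoPointLaw _ ha n) (ε / 3) q) : q ∈ likelyAcceptFirstᶜ := by
  have hn1 : n ≠ 1 := by rintro rfl; simp at hn
  have h1 := mul_le_of_isSuboptimal ha (by linarith [criticalWeight_le hn]) hn1 h
  have h2 := criticalWeight_mul hn
  have hD := one_div_lt_skipValue hn
  intro hq
  have hq' : 1 / 2 < (q 1 : ℝ) := hq
  set D := skipValue n - 1 / (n : ℕ) with hDdef
  have e : (1 - (criticalWeight n - 2 * ε / 3)) * skipValue n -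
      (criticalWeight n - 2 * ε / 3 + (1 - (criticalWeight n - 2 * ε / 3)) / (n : ℕ)) =
      2 * ε / 3 * (1 + D) := by
    linear_combination -h2 - (criticalWeight n - 2 * ε / 3 - 1) * hDdef
  rw [e] at h1
  have hD0 : 0 < ε * D := mul_pos hε (by linarith)
  have h3 := mul_le_mul_of_nonneg_right hq'.le (by linarith : 0 ≤ 2 * ε / 3 * (1 + D))
  linarith

lemma two_thirds_le_toReal_of_learnProb {m : ℕ} {p : PMF ℕ+} {η : ℝ}
    {alg : Kernel (Fin m → ℕ+) Strategy} [IsMarkovKernel alg] {E : Set Strategy}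
    (hE : ∀ q, IsSuboptimal p η q → q ∈ E) (h : 2 / 3 ≤ learnProb p η alg) :
    2 / 3 ≤ (((Measure.pi fun _ : Fin m => p.toMeasure).bind alg) E).toReal := by
  -- Monotonicity holds for outer measure, so measurability of the set of suboptimal strategies is
  -- not needed.
  have h1 := ENNReal.toReal_mono (measure_ne_top _ _) (h.trans (measure_mono hE))
  simpa using h1

lemma sample_lower_bound {n : ℕ} (hn : 3 ≤ n) {ε : ℝ} (hε : 0 < ε) (hεc : ε < criticalWeight n)
    {m : ℕ} (alg : Kernel (Fin m → ℕ+) Strategy) [IsMarkovKernel alg]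
    (h : ∀ p : PMF ℕ+, (∀ k : ℕ+, p k ≠ 0 → (k : ℕ) = 1 ∨ (k : ℕ) = n) →
      2 / 3 ≤ learnProb p (ε / 3) alg) :
    (criticalWeight n - ε) / (9 * ε ^ 2) ≤ m := by
  lift n to ℕ+ using (by omega)
  have hc := criticalWeight_le hn
  have ha : criticalWeight n + 2 * ε / 3 ∈ Set.Icc (0 : ℝ) 1 := ⟨by linarith, by linarith⟩
  have hb : criticalWeight n - 2 * ε / 3 ∈ Set.Icc (0 : ℝ) 1 := ⟨by linarith, by linarith⟩
  have hsupp : ∀ {a : ℝ} (ha : a ∈ Set.Icc (0 : ℝ) 1) (k : ℕ+), twoPointLaw a ha n k ≠ 0 →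
      (k : ℕ) = 1 ∨ (k : ℕ) = n := fun ha k hk => by
    rcases eq_or_eq_of_twoPointLaw_ne_zero ha hk with rfl | rfl <;> simp
  have h1 := two_thirds_le_toReal_of_learnProb
    (fun _ => likelyAcceptFirst_of_isSuboptimal hn hε ha) (h _ (hsupp ha))
  have h2 := two_thirds_le_toReal_of_learnProb
    (fun _ => not_likelyAcceptFirst_of_isSuboptimal hn hε hb) (h _ (hsupp hb))
  rw [bind_pi_twoPointLaw_apply ha n alg measurableSet_likelyAcceptFirst] at h1
  rw [bind_pi_twoPointLaw_apply hb n alg measurableSet_likelyAcceptFirst.compl] at h2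
  simp only [probReal_compl_eq_one_sub measurableSet_likelyAcceptFirst] at h2
  have key := one_le_nine_mul_of_test (bernoulliWeight_nonneg ha) (bernoulliWeight_nonneg hb)
    (sum_bernoulliWeight _) (sum_bernoulliWeight _) (fun _ => measureReal_nonneg)
    (fun _ => measureReal_le_one) h1 h2
  have hx := mul_one_sub_sq_affinity_bernoulliWeight_le hε hεc hc
  rw [div_le_iff₀ (by positivity)]
  have h3 := mul_le_mul_of_nonneg_left hx (by positivity : (0 : ℝ) ≤ 9 * m)
  have h4 := mul_le_mul_of_nonneg_left key (sub_nonneg.2 hεc.le)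
  linarith

end RandomHorizonSecretary

theorem theorem5 :
    ∃ c : ℕ → ℝ,
      (∀ n : ℕ, 3 ≤ n → 0 < c n ∧
        ∀ ε : ℝ, 0 < ε → ε < c n →
          ∀ (m : ℕ) (alg : Kernel (Fin m → ℕ+) RandomHorizonSecretary.Strategy),
            IsMarkovKernel alg →
            (∀ p : PMF ℕ+, (∀ k : ℕ+, p k ≠ 0 → (k : ℕ) = 1 ∨ (k : ℕ) = n) →
              2 / 3 ≤ RandomHorizonSecretary.learnProb p (ε / 3) alg) →
            (c n - ε) / (9 * ε ^ 2) ≤ (m : ℝ)) ∧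
      Tendsto c atTop (𝓝 (1 / (1 + Real.exp 1))) :=
  ⟨RandomHorizonSecretary.criticalWeight,
    fun _ hn => ⟨RandomHorizonSecretary.criticalWeight_pos hn, fun _ hε hεc _ alg _ h =>
      RandomHorizonSecretary.sample_lower_bound hn hε hεc alg h⟩,
    RandomHorizonSecretary.tendsto_criticalWeight⟩
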